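/- A 3SAT formula is a conjunction of clauses, each a disjunction of three literals on three different variables. For a 3SAT formula $\Phi$ with $N$ variables let $\mathrm{SAT}(\Phi)=\mathrm{conv}\{x\in\{0,1\}^N : x \text{ satisfies } \Phi\}$. An extension of a polytope $P$ is a polytope $Q\subseteq\mathbb{R}^e$ (for some $e$) of which $P$ is the image under a linear map, and the extension complexity $\mathrm{xc}(P)$ is the minimum number of facets of an extension of $P$. For $m\ge 0$ let $\mathrm{CUT}^{\square}(K_m)\subseteq\mathbb{R}^{\binom m2}$ be the convex hull of the cut vectors $\delta(S)$, $S\subseteq[m]$, where $\delta_{ij}(S)=1$ if $|S\cap\{i,j\}|=1$ and $\delta_{ij}(S)=0$ otherwise. Let $\Phi_m$ be the 3SAT formula in the $\binom{m+1}{2}$ variables $x_{ij}=x_{ji}$ $(i,j\in[m])$ $$\Phi_m=\bigwedge_{1\le i<j\le m}\bigl[(x_{ii}\lor\overline{x}_{jj}\lor x_{ij})\land(\overline{x}_{ii}\lor x_{jj}\lor x_{ij})\land(x_{ii}\lor x_{jj}\lor\overline{x}_{ij})\land(\overline{x}_{ii}\lor\overline{x}_{jj}\lor\overline{x}_{ij})\bigr].$$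 Theorem. 1. There are constants $C,c>0$ such that for every integer $n\ge1$ there is a 3SAT formula $\Phi$ with at most $Cn$ variables and at most $Cn$ clauses and $\mathrm{xc}(\mathrm{SAT}(\Phi))\ge 2^{c\sqrt n}$. 2. For every $m\ge 0$, an assignment satisfies $\Phi_m$ if and only if $x_{ij}=x_{ii}\oplus x_{jj}$ for all $i\ne j$; $\Phi_m$ has $\binom{m+1}{2}$ variables and $4\binom m2$ clauses; and $\mathrm{CUT}^{\square}(K_m)$ is the image of $\mathrm{SAT}(\Phi_m)$ under the coordinate projection that deletes the coordinates $x_{ii}$, $i\in[m]$. 3. There is a constant $c>0$ such that $\mathrm{xc}(\mathrm{SAT}(\Phi_m))\ge 2^{cm}$ for every $m\ge1$. -/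

import Mathlib

noncomputable section

/-! ### Polytopes, facets and extension complexity -/

/-- A (convex) polytope: the convex hull of a finite set of points. -/
def IsPolytope {E : Type*} [AddCommGroup E] [Module ℝ E] (P : Set E) : Prop :=
  ∃ V : Finset E, P = convexHull ℝ (V : Set E)

open Classical in
/-- The dimension of a polytope is the dimension of its affine hull; the empty polytope has
dimension `-1`. -/
def polytopeDim {E : Type*} [AddCommGroup E] [Module ℝ E] (P : Set E) : ℤ :=
  if P.Nonempty then (Module.finrank ℝ (affineSpan ℝ P).direction : ℤ) else -1

/-- The facets of `P`: the faces of dimension `dim P - 1`. A face of a polytope is the set of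
points at which some linear functional attains its maximum over the polytope, or the empty set;
these are the exposed subsets of Mathlib. -/
def facets {E : Type*} [AddCommGroup E] [Module ℝ E] [TopologicalSpace E] (P : Set E) :
    Set (Set E) :=
  {F | IsExposed ℝ P F ∧ polytopeDim F = polytopeDim P - 1}

/-- `Q ⊆ ℝ^e` is an extension of `P`: a polytope of which `P` is the image under a linear map. -/
def IsExtension {ι : Type*} {e : ℕ} (Q : Set (Fin e → ℝ)) (P : Set (ι → ℝ)) : Prop :=
  IsPolytope Q ∧ ∃ f : (Fin e → ℝ) →ₗ[ℝ] (ι → ℝ), f '' Q = P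

/-- The extension complexity of `P`: the minimum number of facets of an extension of `P`. -/
def extensionComplexity {ι : Type*} (P : Set (ι → ℝ)) : ℕ :=
  sInf {k : ℕ | ∃ (e : ℕ) (Q : Set (Fin e → ℝ)), IsExtension Q P ∧ (facets Q).ncard = k}

/-! ### 3SAT formulas and their polytopes -/

/-- A clause with exactly three literals, on three different variables. The `k`-th literal is the
variable `var k` if `sign k = true`, and its negation if `sign k = false`. -/
structure ThreeClause (σ : Type*) where
  var : Fin 3 ↪ σ
  sign : Fin 3 → Bool

/-- The clause is true under the assignment `a`: one of its literals is. -/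
def ThreeClause.Holds {σ : Type*} (C : ThreeClause σ) (a : σ → Bool) : Prop :=
  ∃ k, a (C.var k) = C.sign k

/-- A 3SAT formula in conjunctive normal form over the variables `σ`: a conjunction of finitely
many clauses with three literals. -/
abbrev ThreeCNF (σ : Type*) := Finset (ThreeClause σ)

/-- The assignment `a` satisfies the formula `Φ`. -/
def ThreeCNF.Satisfies {σ : Type*} (Φ : ThreeCNF σ) (a : σ → Bool) : Prop :=
  ∀ C ∈ Φ, C.Holds a

/-- The 0/1 vector of an assignment. -/
def assignmentVector {σ : Type*} (a : σ → Bool) : σ → ℝ := fun v => if a v then 1 else 0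

/-- `SAT(Φ)`: the convex hull of the satisfying assignments of `Φ`, as 0/1 vectors. -/
def satPolytope {σ : Type*} (Φ : ThreeCNF σ) : Set (σ → ℝ) :=
  convexHull ℝ (assignmentVector '' {a | ThreeCNF.Satisfies Φ a})

/-! ### The cut polytope -/

open Classical in
/-- The cut vector of `S ⊆ V`: its coordinate at the edge `uv` is `1` if `|S ∩ {u, v}| = 1`, and
`0` otherwise. -/
def cutVector {V : Type*} (G : SimpleGraph V) (S : Set V) : G.edgeSet → ℝ :=
  fun e => if {v | v ∈ S ∧ v ∈ e.1}.ncard = 1 then 1 else 0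

/-- The cut polytope of the graph `G`, in the space indexed by the edges of `G`. -/
def cutPolytope {V : Type*} (G : SimpleGraph V) : Set (G.edgeSet → ℝ) :=
  convexHull ℝ (Set.range (cutVector G))

/-! ### The formula `Φ_m`

Its variables `x_ij = x_ji`, for `i, j ∈ [m]` (`i = j` allowed), are indexed by the unordered pairs
`s(i, j)`. -/

/-- The three variables `x_ii`, `x_jj`, `x_ij` for `i ≠ j`. -/
def xorVars {m : ℕ} (i j : Fin m) (h : i ≠ j) : Fin 3 ↪ Sym2 (Fin m) where
  toFun := ![s(i, i), s(j, j), s(i, j)]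
  inj' := by
    intro a b
    fin_cases a <;> fin_cases b <;> simp [h, h.symm]

open Classical in
/-- The four clauses `x_ii ∨ ¬x_jj ∨ x_ij`, `¬x_ii ∨ x_jj ∨ x_ij`, `x_ii ∨ x_jj ∨ ¬x_ij` and
`¬x_ii ∨ ¬x_jj ∨ ¬x_ij`. -/
def xorClauses {m : ℕ} (i j : Fin m) (h : i ≠ j) : ThreeCNF (Sym2 (Fin m)) :=
  {⟨xorVars i j h, ![true, false, true]⟩, ⟨xorVars i j h, ![false, true, true]⟩,
    ⟨xorVars i j h, ![true, true, false]⟩, ⟨xorVars i j h, ![false, false, false]⟩}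

open Classical in
/-- `Φ_m`: the conjunction of these four clauses over all pairs `i < j` in `[m]`. -/
def cutFormula (m : ℕ) : ThreeCNF (Sym2 (Fin m)) :=
  Finset.univ.biUnion fun p : {p : Fin m × Fin m // p.1 < p.2} =>
    xorClauses p.1.1 p.1.2 p.2.ne

end

/-! Satisfying assignments of `cutFormula m` correspond to vectors b in {0,1}^m, and b_i b_j is
linear in the variables: twice it is x_ii + x_jj - x_ij. So for every a the value (1 - |a ∩ b|)^2 is
an affine function of the vertex, nonnegative on the polytope.

In an extension Q, the zero set of the pulled-back function of a is a face F_a, and the vertex of b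
lifts to a point w_b. If a and b are disjoint, w_b is off F_a, so some facet contains F_a but not
w_b (`IsPolytope.exists_facet`). If |a ∩ b| = 1, then w_b lies in F_a and no facet does this. Each
facet thus gives a rectangle of pairs (a, b) avoiding intersection size one, and these rectangles
cover all 3^m disjoint pairs. Such a rectangle holds at most 2^m of them (`disjointPairs_le`), so Q
has at least (3/2)^m facets. The first part takes m = ⌊√n⌋. -/

noncomputable section

/-! ### Facets of polytopes -/

section Facets

variable {E : Type*} [NormedAddCommGroup E] [NormedSpace ℝ E]

theorem IsPolytope.convex {P : Set E} (hP : IsPolytope P) : Convex ℝ P := by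
  obtain ⟨V, rfl⟩ := hP
  exact convex_convexHull ℝ _

theorem IsPolytope.isCompact {P : Set E} (hP : IsPolytope P) : IsCompact P := by
  obtain ⟨V, rfl⟩ := hP
  exact V.finite_toSet.isCompact_convexHull ℝ

/-- A polytope has finitely many exposed faces. -/
theorem IsPolytope.finite_setOf_isExposed {P : Set E} (hP : IsPolytope P) :
    {F | IsExposed ℝ P F}.Finite := by
  have hc := hP.isCompact
  have hconv := hP.convex
  obtain ⟨V, rfl⟩ := hP
  -- A face is the closed convex hull of its extreme points, and these belong to `V`.
  refine Set.Finite.of_finite_image (f := fun F => F.extremePoints ℝ)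
    (V.finite_toSet.finite_subsets.subset ?_) ?_
  · rintro _ ⟨F, hF, rfl⟩
    exact hF.isExtreme.extremePoints_subset_extremePoints.trans extremePoints_convexHull_subset
  · intro F hF G hG h
    have h' : F.extremePoints ℝ = G.extremePoints ℝ := h
    rw [← closure_convexHull_extremePoints (hF.isCompact hc) (hF.convex hconv), h',
      closure_convexHull_extremePoints (hG.isCompact hc) (hG.convex hconv)]

theorem IsPolytope.finite_facets {P : Set E} (hP : IsPolytope P) : (facets P).Finite :=
  hP.finite_setOf_isExposed.subset fun _ hF => hF.1

theorem polytopeDim_of_nonempty {P : Set E} (hP : P.Nonempty) :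
    polytopeDim P = Module.finrank ℝ (vectorSpan ℝ P) := by
  rw [polytopeDim, if_pos hP, direction_affineSpan]

theorem nonneg_on_convexHull {V : Set E} (g : E →ᵃ[ℝ] ℝ) (hg : ∀ v ∈ V, 0 ≤ g v) :
    ∀ x ∈ convexHull ℝ V, 0 ≤ g x :=
  convexHull_min hg ((convex_Ici (0 : ℝ)).affine_preimage g)

variable [FiniteDimensional ℝ E]

/-- The zero set of a nonnegative affine function on `P` is an exposed face of `P`. -/
theorem isExposed_zeros {P : Set E} (g : E →ᵃ[ℝ] ℝ) (hg : ∀ x ∈ P, 0 ≤ g x) :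
    IsExposed ℝ P {x ∈ P | g x = 0} := by
  rintro ⟨z, hz, hz0⟩
  -- Exposed faces are sets of maximisers, hence the sign; the zero `z` shows that the minimum of
  -- `g` is 0.
  refine ⟨LinearMap.toContinuousLinearMap (-g.linear), ?_⟩
  have key : ∀ x y, g x - g y = g.linear x - g.linear y := fun x y => by
    rw [← map_sub g.linear, ← vsub_eq_sub x y, g.linearMap_vsub, vsub_eq_sub]
  ext x
  simp only [Set.mem_ofPred_eq, LinearMap.coe_toContinuousLinearMap', LinearMap.neg_apply,
    neg_le_neg_iff]
  refine and_congr_right fun hx => ⟨fun h y hy => ?_, fun h => ?_⟩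
  · linarith [key y x, hg y hy]
  · linarith [key z x, hg x hx, h z hz]

/-- The convention that the empty set has dimension -1 lets the bound include `F = ∅`. -/
theorem finrank_vectorSpan_insert_le_polytopeDim (F : Set E) (w : E) :
    (Module.finrank ℝ (vectorSpan ℝ (insert w F)) : ℤ) ≤ polytopeDim F + 1 := by
  rcases F.eq_empty_or_nonempty with rfl | hF
  · simp [polytopeDim]
  · rw [polytopeDim_of_nonempty hF]
    exact_mod_cast finrank_vectorSpan_insert_le_set ℝ F w

/-- A proper face has smaller dimension. -/
theorem polytopeDim_zeros_lt {P : Set E} (g : E →ᵃ[ℝ] ℝ) {w : E} (hw : w ∈ P) (hpos : 0 < g w) :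
    polytopeDim {x ∈ P | g x = 0} < polytopeDim P := by
  rw [polytopeDim_of_nonempty ⟨w, hw⟩]
  rcases Set.eq_empty_or_nonempty {x ∈ P | g x = 0} with h | ⟨z, hz⟩
  · rw [h]
    simp only [polytopeDim, Set.not_nonempty_empty, if_false]
    omega
  · rw [polytopeDim_of_nonempty ⟨z, hz⟩, Nat.cast_lt]
    refine Submodule.finrank_lt_finrank_of_lt
      (lt_of_le_of_ne (vectorSpan_mono ℝ fun x hx => hx.1) fun h => ?_)
    have h1 : w -ᵥ z ∈ vectorSpan ℝ {x ∈ P | g x = 0} := by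
      rw [h]
      exact vsub_mem_vectorSpan ℝ hw hz.1
    have h2 : vectorSpan ℝ {x ∈ P | g x = 0} ≤ LinearMap.ker g.linear := by
      refine Submodule.span_le.2 ?_
      rintro _ ⟨x, hx, y, hy, rfl⟩
      change g.linear (x -ᵥ y) = 0
      rw [g.linearMap_vsub, hx.2, hy.2, vsub_self]
    have h3 := h2 h1
    rw [LinearMap.mem_ker, g.linearMap_vsub, hz.2] at h3
    simp at h3
    exact hpos.ne' h3

/-- A face of dimension less than `dim P - 1` and a point `w` of `P` lie in the zero set of an
affine function that is positive somewhere on `P`. -/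
theorem exists_affineMap_eq_zero_pos {V : Finset E} {F : Set E} {w : E}
    (hw : w ∈ convexHull ℝ (V : Set E))
    (hF : polytopeDim F + 1 < polytopeDim (convexHull ℝ (V : Set E))) :
    ∃ h : E →ᵃ[ℝ] ℝ, h w = 0 ∧ (∀ x ∈ F, h x = 0) ∧ ∃ v ∈ V, 0 < h v := by
  have hlt := (finrank_vectorSpan_insert_le_polytopeDim F w).trans_lt hF
  rw [polytopeDim_of_nonempty ⟨w, hw⟩, Nat.cast_lt] at hlt
  obtain ⟨u, hu, hu'⟩ : ∃ u ∈ vectorSpan ℝ (convexHull ℝ (V : Set E)),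
      u ∉ vectorSpan ℝ (insert w F) := by
    by_contra! hcon
    exact hlt.not_ge (Submodule.finrank_mono hcon)
  -- `f` is constant on `insert w F` but not on the polytope, since it does not kill the direction
  -- `u`; subtracting `f w` and choosing a sign gives `h`.
  obtain ⟨f, hfu, hf⟩ := Submodule.exists_le_ker_of_notMem hu'
  obtain ⟨v, hv, hne⟩ : ∃ v ∈ V, f v - f w ≠ 0 := by
    by_contra! hcon
    have hconst : ∀ x ∈ convexHull ℝ (V : Set E), f x = f w :=
      convexHull_min (fun x hx => sub_eq_zero.1 (hcon x hx))
        ((convex_singleton (f w)).linear_preimage f)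
    refine hfu ?_
    have hker : vectorSpan ℝ (convexHull ℝ (V : Set E)) ≤ LinearMap.ker f := by
      refine Submodule.span_le.2 ?_
      rintro _ ⟨x, hx, y, hy, rfl⟩
      simp [hconst x hx, hconst y hy]
    exact hker hu
  have hF0 : ∀ x ∈ F, f x - f w = 0 := fun x hx => by
    rw [← map_sub]
    exact hf (vsub_mem_vectorSpan ℝ (Set.mem_insert_of_mem _ hx) (Set.mem_insert w F))
  let h : E →ᵃ[ℝ] ℝ := f.toAffineMap - AffineMap.const ℝ E (f w)
  have hh : ∀ x, h x = f x - f w := fun x => by simp [h]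
  rcases hne.lt_or_gt with hlt | hgt
  · refine ⟨-h, by simp [hh], fun x hx => ?_, v, hv, ?_⟩
    · change -h x = 0
      rw [hh, hF0 x hx, neg_zero]
    · change 0 < -h v
      rw [hh]
      linarith
  · exact ⟨h, by simp [hh], fun x hx => by rw [hh, hF0 x hx], v, hv, by rwa [hh]⟩

/-- A face of a polytope and a point of the polytope off it are separated by a facet: some facet
contains the face but not the point. -/
theorem IsPolytope.exists_facet {P : Set E} (hP : IsPolytope P) (g : E →ᵃ[ℝ] ℝ)
    (hg : ∀ x ∈ P, 0 ≤ g x) {w : E} (hw : w ∈ P) (hpos : 0 < g w) :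
    ∃ G ∈ facets P, {x ∈ P | g x = 0} ⊆ G ∧ w ∉ G := by
  classical
  obtain ⟨V, rfl⟩ := hP
  -- Induction on the number of points of `V` off the face: while the face is not a facet, `g` is
  -- tilted so that the face gains a point of `V` and still misses `w`.
  induction hk : (V.filter fun v => 0 < g v).card using Nat.strong_induction_on generalizing g with
  | _ k ih =>
  have hVP : ∀ v ∈ V, v ∈ convexHull ℝ (V : Set E) := fun v hv => subset_convexHull ℝ _ hv
  by_cases hdim : polytopeDim {x ∈ convexHull ℝ (V : Set E) | g x = 0} =
      polytopeDim (convexHull ℝ (V : Set E)) - 1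
  · exact ⟨_, ⟨isExposed_zeros g hg, hdim⟩, subset_rfl, fun h => hpos.ne' h.2⟩
  have hlt := polytopeDim_zeros_lt g hw hpos
  obtain ⟨h, hhw, hh0, v₀, hv₀, hhv₀⟩ := exists_affineMap_eq_zero_pos hw
    (F := {x ∈ convexHull ℝ (V : Set E) | g x = 0}) (by omega)
  obtain ⟨v₁, hv₁, hmin⟩ := (V.filter fun v => 0 < h v).exists_min_image (fun v => g v / h v)
    ⟨v₀, by simp [hv₀, hhv₀]⟩
  simp only [Finset.mem_filter] at hv₁ hmin
  have hg₁ : 0 < g v₁ := (hg v₁ (hVP _ hv₁.1)).lt_of_ne' fun h0 =>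
    hv₁.2.ne' (hh0 _ ⟨hVP _ hv₁.1, h0⟩)
  -- The largest `t` for which `g - t • h` stays nonnegative on `V`; the tilted function vanishes at
  -- `v₁`, and its value at `w` is unchanged because `h w = 0`.
  set t := g v₁ / h v₁ with ht
  have htpos : 0 < t := div_pos hg₁ hv₁.2
  let g' : E →ᵃ[ℝ] ℝ := g - t • h
  have hg'x : ∀ x, g' x = g x - t * h x := fun x => by simp [g']
  have hg' : ∀ x ∈ convexHull ℝ (V : Set E), 0 ≤ g' x := by
    refine nonneg_on_convexHull g' fun v hv => ?_
    rw [hg'x]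
    rcases le_or_gt (h v) 0 with hle | hgt
    · nlinarith [hg v (hVP v hv)]
    · have := hmin v ⟨hv, hgt⟩
      rw [le_div_iff₀ hgt] at this
      linarith
  have hg'w : 0 < g' w := by rw [hg'x, hhw]; simpa using hpos
  have hsub : ∀ x ∈ convexHull ℝ (V : Set E), g x = 0 → g' x = 0 := fun x hx h0 => by
    rw [hg'x, h0, hh0 x ⟨hx, h0⟩]
    simp
  obtain ⟨G, hG, hGsub, hwG⟩ := ih _ (by
    rw [← hk]
    refine Finset.card_lt_card (Finset.ssubset_iff_of_subset ?_ |>.2 ⟨v₁, ?_, ?_⟩)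
    · intro v hv
      rw [Finset.mem_filter] at hv ⊢
      exact ⟨hv.1, (hg v (hVP v hv.1)).lt_of_ne' fun h0 => hv.2.ne' (hsub v (hVP v hv.1) h0)⟩
    · simp [hv₁.1, hg₁]
    · simp [hg'x, ht, hv₁.2.ne']) g' hg'w hg' rfl
  exact ⟨G, hG, fun x hx => hGsub ⟨hx.1, hsub x hx.1 hx.2⟩, hwG⟩

end Facets

/-! ### Rectangles of disjoint pairs -/

/-- The size of the intersection of two sets, given by their indicators. -/
def interCard {n : ℕ} (a b : Fin n → Bool) : ℕ := ∑ i, (a i && b i).toNat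

theorem interCard_cons {n : ℕ} (x y : Bool) (a b : Fin n → Bool) :
    interCard (Fin.cons x a : Fin (n + 1) → Bool) (Fin.cons y b : Fin (n + 1) → Bool) =
      (x && y).toNat + interCard a b := by
  simp [interCard, Fin.sum_univ_succ]

open Classical in
/-- The number of disjoint pairs in the rectangle `A × B`. -/
def disjointPairs {n : ℕ} (A B : Set (Fin n → Bool)) : ℕ :=
  ∑ a, ∑ b, if a ∈ A ∧ b ∈ B ∧ interCard a b = 0 then 1 else 0

/-- The section of `A` at the first coordinate. -/
def consSection {n : ℕ} (A : Set (Fin (n + 1) → Bool)) (x : Bool) : Set (Fin n → Bool) :=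
  {a | (Fin.cons x a : Fin (n + 1) → Bool) ∈ A}

theorem Fin.sum_bool_cons {n : ℕ} (f : (Fin (n + 1) → Bool) → ℕ) :
    ∑ a, f a = ∑ a : Fin n → Bool, (f (Fin.cons true a) + f (Fin.cons false a)) := by
  rw [← (Fin.consEquiv fun _ => Bool).sum_comp f, Fintype.sum_prod_type, Fintype.sum_bool,
    Finset.sum_add_distrib]
  rfl

/-- The first coordinates of a disjoint pair are not both `true`, which leaves three cases. -/
theorem disjointPairs_succ {n : ℕ} (A B : Set (Fin (n + 1) → Bool)) :
    disjointPairs A B = disjointPairs (consSection A false) (consSection B false) +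
      disjointPairs (consSection A true) (consSection B false) +
      disjointPairs (consSection A false) (consSection B true) := by
  classical
  simp only [disjointPairs, Fin.sum_bool_cons, ← Finset.sum_add_distrib]
  refine Finset.sum_congr rfl fun a _ => Finset.sum_congr rfl fun b _ => ?_
  simp only [interCard_cons, consSection, Set.mem_ofPred_eq, Bool.and_true, Bool.and_false,
    Bool.toNat_true, Bool.toNat_false, zero_add, Nat.add_eq_zero_iff, one_ne_zero, false_and,
    and_false, if_false]
  have h : ∀ x y z : ℕ, x + (y + z) = z + x + y := fun x y z => by ring
  exact h _ _ _

theorem disjointPairs_univ (n : ℕ) :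
    disjointPairs (Set.univ : Set (Fin n → Bool)) Set.univ = 3 ^ n := by
  induction n with
  | zero => simp [disjointPairs, interCard]
  | succ n ih =>
    have h : ∀ x, consSection (Set.univ : Set (Fin (n + 1) → Bool)) x = Set.univ := fun x => rfl
    rw [disjointPairs_succ, h, h, ih]
    ring

/-- A rectangle without pairs meeting in exactly one element has at most `2 ^ n` disjoint
pairs. -/
theorem disjointPairs_le {n : ℕ} {A B : Set (Fin n → Bool)}
    (h : ∀ a ∈ A, ∀ b ∈ B, interCard a b ≠ 1) : disjointPairs A B ≤ 2 ^ n := by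
  induction n with
  | zero =>
    classical
    simp only [disjointPairs, Fintype.sum_unique, pow_zero]
    split_ifs <;> simp
  | succ n ih =>
    have h00 : ∀ a ∈ consSection A false, ∀ b ∈ consSection B false, interCard a b ≠ 1 :=
      fun a ha b hb => by simpa [interCard_cons] using h _ ha _ hb
    have h01 : ∀ a ∈ consSection A false, ∀ b ∈ consSection B true, interCard a b ≠ 1 :=
      fun a ha b hb => by simpa [interCard_cons] using h _ ha _ hb
    have h10 : ∀ a ∈ consSection A true, ∀ b ∈ consSection B false, interCard a b ≠ 1 :=
      fun a ha b hb => by simpa [interCard_cons] using h _ ha _ hb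
    have h11 : ∀ a ∈ consSection A true, ∀ b ∈ consSection B true, interCard a b ≠ 0 :=
      fun a ha b hb => by simpa [interCard_cons] using h _ ha _ hb
    have i1 := ih (A := consSection A false) (B := consSection B false ∪ consSection B true)
      fun a ha b hb => hb.elim (h00 a ha b) (h01 a ha b)
    have i2 := ih (A := consSection A false ∪ consSection A true) (B := consSection B false)
      fun a ha b hb => ha.elim (fun ha => h00 a ha b hb) (fun ha => h10 a ha b hb)
    -- By `h11`, a disjoint pair of tails cannot have both `true` extensions in the rectangle. So
    -- the three section counts fit into two rectangles, each still avoiding intersection size one.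
    have key : disjointPairs A B ≤
        disjointPairs (consSection A false) (consSection B false ∪ consSection B true) +
        disjointPairs (consSection A false ∪ consSection A true) (consSection B false) := by
      classical
      rw [disjointPairs_succ]
      simp only [disjointPairs, ← Finset.sum_add_distrib]
      refine Finset.sum_le_sum fun a _ => Finset.sum_le_sum fun b _ => ?_
      by_cases h0 : interCard a b = 0
      · have := fun ha hb => h11 a ha b hb h0
        simp only [h0, and_true, Set.mem_union]
        by_cases a0 : a ∈ consSection A false <;> by_cases a1 : a ∈ consSection A true <;>
          by_cases b0 : b ∈ consSection B false <;> by_cases b1 : b ∈ consSection B true <;>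
          simp_all
      · simp [h0]
    rw [pow_succ]
    omega

/-- Finitely many rectangles without pairs meeting in exactly one element that cover all disjoint
pairs number at least `(3 / 2) ^ n`. -/
theorem three_pow_le_card_mul_two_pow {n : ℕ} {κ : Type*} (s : Finset κ)
    (A B : κ → Set (Fin n → Bool))
    (h : ∀ k ∈ s, ∀ a ∈ A k, ∀ b ∈ B k, interCard a b ≠ 1)
    (hcov : ∀ a b, interCard a b = 0 → ∃ k ∈ s, a ∈ A k ∧ b ∈ B k) :
    3 ^ n ≤ s.card * 2 ^ n := by
  classical
  calc 3 ^ n = disjointPairs (Set.univ : Set (Fin n → Bool)) Set.univ :=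
        (disjointPairs_univ n).symm
    _ ≤ ∑ k ∈ s, disjointPairs (A k) (B k) := by
        simp only [disjointPairs]
        rw [Finset.sum_comm (s := s)]
        refine Finset.sum_le_sum fun a _ => ?_
        rw [Finset.sum_comm (s := s)]
        refine Finset.sum_le_sum fun b _ => ?_
        by_cases h0 : interCard a b = 0
        · obtain ⟨k, hk, ha, hb⟩ := hcov a b h0
          have hle := Finset.single_le_sum (s := s) (f := fun k =>
            (if a ∈ A k ∧ b ∈ B k ∧ interCard a b = 0 then 1 else 0 : ℕ))
            (fun _ _ => Nat.zero_le _) hk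
          simpa only [h0, ha, hb, Set.mem_univ, and_self, and_true, if_true] using hle
        · simp [h0]
    _ ≤ ∑ k ∈ s, 2 ^ n := Finset.sum_le_sum fun k hk => disjointPairs_le (h k hk)
    _ = s.card * 2 ^ n := by rw [Finset.sum_const, smul_eq_mul]

/-! ### Extension complexity -/

theorem IsExtension.image {ι κ : Type*} {e : ℕ} {Q : Set (Fin e → ℝ)} {P : Set (ι → ℝ)}
    (h : IsExtension Q P) (f : (ι → ℝ) →ₗ[ℝ] (κ → ℝ)) : IsExtension Q (f '' P) := by
  obtain ⟨hQ, g, rfl⟩ := h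
  exact ⟨hQ, f ∘ₗ g, by rw [← Set.image_comp]; rfl⟩

theorem IsPolytope.image {E F : Type*} [AddCommGroup E] [Module ℝ E] [AddCommGroup F] [Module ℝ F]
    {P : Set E} (hP : IsPolytope P) (f : E →ₗ[ℝ] F) : IsPolytope (f '' P) := by
  classical
  obtain ⟨V, rfl⟩ := hP
  exact ⟨V.image f, by rw [f.image_convexHull, Finset.coe_image]⟩

theorem IsPolytope.exists_isExtension {ι : Type*} [Finite ι] {P : Set (ι → ℝ)}
    (hP : IsPolytope P) : ∃ (e : ℕ) (Q : Set (Fin e → ℝ)), IsExtension Q P := by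
  obtain ⟨e, ⟨r⟩⟩ := Finite.exists_equiv_fin ι
  let f := LinearMap.funLeft ℝ ℝ r
  let g := LinearMap.funLeft ℝ ℝ r.symm
  refine ⟨e, g '' P, hP.image g, f, ?_⟩
  rw [← Set.image_comp]
  convert Set.image_id P
  ext x
  simp [f, g, LinearMap.funLeft_apply]

/-- A minimal extension exists. -/
theorem IsPolytope.exists_isExtension_ncard {ι : Type*} [Finite ι] {P : Set (ι → ℝ)}
    (hP : IsPolytope P) : ∃ (e : ℕ) (Q : Set (Fin e → ℝ)), IsExtension Q P ∧
      (facets Q).ncard = extensionComplexity P := by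
  obtain ⟨e, Q, hQ⟩ := hP.exists_isExtension
  -- Nonemptiness makes `sInf` an attained minimum, not the default value 0 of the empty set.
  exact Nat.sInf_mem (s := {k : ℕ | ∃ (e : ℕ) (Q : Set (Fin e → ℝ)),
    IsExtension Q P ∧ (facets Q).ncard = k}) ⟨_, e, Q, hQ, rfl⟩

theorem extensionComplexity_image_le {ι κ : Type*} [Finite ι] {P : Set (ι → ℝ)}
    (hP : IsPolytope P) (f : (ι → ℝ) →ₗ[ℝ] (κ → ℝ)) :
    extensionComplexity (f '' P) ≤ extensionComplexity P := by
  obtain ⟨e, Q, hQ, hk⟩ := hP.exists_isExtension_ncard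
  exact Nat.sInf_le ⟨e, Q, hQ.image f, hk⟩

/-- A polytope whose slack matrix contains the matrix `(1 - |a ∩ b|) ^ 2` has extension complexity
at least `(3 / 2) ^ n`. -/
theorem three_pow_le_extensionComplexity_mul {ι : Type*} [Finite ι] {n : ℕ} {P : Set (ι → ℝ)}
    (hP : IsPolytope P) (φ : (Fin n → Bool) → (ι → ℝ) →ᵃ[ℝ] ℝ) (p : (Fin n → Bool) → ι → ℝ)
    (hp : ∀ b, p b ∈ P) (hφ : ∀ a, ∀ x ∈ P, 0 ≤ φ a x)
    (hφp : ∀ a b, φ a (p b) = (1 - (interCard a b : ℝ)) ^ 2) :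
    3 ^ n ≤ extensionComplexity P * 2 ^ n := by
  obtain ⟨e, Q, ⟨hQ, f, rfl⟩, hk⟩ := hP.exists_isExtension_ncard
  choose w hwQ hw using hp
  -- Finiteness matters here: `ncard` of an infinite set would be 0.
  rw [← hk, Set.ncard_eq_toFinset_card _ hQ.finite_facets]
  refine three_pow_le_card_mul_two_pow _
    (fun G => {a | {x ∈ Q | ((φ a).comp f.toAffineMap) x = 0} ⊆ G}) (fun G => {b | w b ∉ G}) ?_ ?_
  · intro G _ a ha b hb h1
    refine hb (ha ⟨hwQ b, ?_⟩)
    simp [hw, hφp, h1]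
  · intro a b h0
    obtain ⟨G, hG, hsub, hwG⟩ := hQ.exists_facet ((φ a).comp f.toAffineMap)
      (fun x hx => hφ a _ ⟨x, hx, rfl⟩) (hwQ b) (by simp [hw, hφp, h0])
    exact ⟨G, by simpa using hG, hsub, hwG⟩

/-! ### The formulas -/

theorem isPolytope_satPolytope {σ : Type*} [Finite σ] (Φ : ThreeCNF σ) :
    IsPolytope (satPolytope Φ) :=
  ⟨(Set.toFinite (assignmentVector '' {a | Φ.Satisfies a})).toFinset, by
    rw [Set.Finite.coe_toFinset]; rfl⟩

theorem xorVars_zero {m : ℕ} (i j : Fin m) (h : i ≠ j) : xorVars i j h 0 = s(i, i) := rfl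

theorem xorVars_one {m : ℕ} (i j : Fin m) (h : i ≠ j) : xorVars i j h 1 = s(j, j) := rfl

theorem xorVars_two {m : ℕ} (i j : Fin m) (h : i ≠ j) : xorVars i j h 2 = s(i, j) := rfl

/-- Each of the four clauses of a pair excludes exactly one of the four triples violating the XOR
relation. -/
theorem cutFormula_satisfies_iff {m : ℕ} (a : Sym2 (Fin m) → Bool) :
    (cutFormula m).Satisfies a ↔
      ∀ i j : Fin m, i ≠ j → a s(i, j) = xor (a s(i, i)) (a s(j, j)) := by
  have key : ∀ i j (h : i ≠ j), (xorClauses i j h).Satisfies a ↔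
      a s(i, j) = xor (a s(i, i)) (a s(j, j)) := by
    intro i j h
    simp only [ThreeCNF.Satisfies, xorClauses, ThreeClause.Holds, Finset.mem_insert,
      Finset.mem_singleton, forall_eq_or_imp, forall_eq, Fin.exists_fin_succ]
    cases h1 : a s(i, i) <;> cases h2 : a s(j, j) <;> cases h3 : a s(i, j) <;>
      simp [xorVars_zero, xorVars_one, xorVars_two, h1, h2, h3]
  have h1 : (cutFormula m).Satisfies a ↔
      ∀ p : {p : Fin m × Fin m // p.1 < p.2}, (xorClauses p.1.1 p.1.2 p.2.ne).Satisfies a := by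
    simp only [ThreeCNF.Satisfies, cutFormula, Finset.mem_biUnion, Finset.mem_univ, true_and]
    exact ⟨fun h p C hC => h C ⟨p, hC⟩, fun h C ⟨p, hC⟩ => h p C hC⟩
  rw [h1]
  constructor
  · intro h i j hij
    rcases hij.lt_or_gt with hlt | hgt
    · exact (key i j hij).1 (h ⟨(i, j), hlt⟩)
    · rw [Sym2.eq_swap, Bool.xor_comm]
      exact (key j i hij.symm).1 (h ⟨(j, i), hgt⟩)
  · exact fun h p => (key _ _ _).2 (h _ _ p.2.ne)

theorem card_xorClauses {m : ℕ} (i j : Fin m) (h : i ≠ j) : (xorClauses i j h).card = 4 := by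
  classical
  rw [xorClauses, Finset.card_insert_of_notMem, Finset.card_insert_of_notMem,
    Finset.card_insert_of_notMem, Finset.card_singleton] <;> simp

theorem card_cutFormula (m : ℕ) : (cutFormula m).card = 4 * m.choose 2 := by
  classical
  rw [cutFormula, Finset.card_biUnion]
  · simp only [card_xorClauses, Finset.sum_const, smul_eq_mul, Finset.card_univ]
    rw [Fintype.card_subtype, Fintype.card_product_filter_lt, Fintype.card_fin, mul_comm]
  · rintro ⟨⟨i, j⟩, hij⟩ - ⟨⟨k, l⟩, hkl⟩ - hne
    rw [Function.onFun, Finset.disjoint_left]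
    intro C h1 h2
    -- A clause determines its pair: its first two variables are x_ii and x_jj.
    have v1 : ∀ (i j : Fin m) (h : i ≠ j), C ∈ xorClauses i j h → C.var = xorVars i j h := by
      intro i j h hC
      simp only [xorClauses, Finset.mem_insert, Finset.mem_singleton] at hC
      rcases hC with rfl | rfl | rfl | rfl <;> rfl
    have hv := (v1 _ _ _ h1).symm.trans (v1 _ _ _ h2)
    have e0 := DFunLike.congr_fun hv 0
    have e1 := DFunLike.congr_fun hv 1
    simp [xorVars_zero, xorVars_one] at e0 e1
    exact hne (by simp [e0, e1])

/-- The assignment `x_ii = b i`, `x_ij = b i ⊕ b j`. -/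
def xorAssignment {m : ℕ} (b : Fin m → Bool) : Sym2 (Fin m) → Bool :=
  Sym2.lift ⟨fun i j => if i = j then b i else xor (b i) (b j), fun i j => by
    by_cases h : i = j
    · simp [h]
    · simp [h, Ne.symm h, Bool.xor_comm]⟩

theorem xorAssignment_diag {m : ℕ} (b : Fin m → Bool) (i : Fin m) :
    xorAssignment b s(i, i) = b i := by
  simp [xorAssignment]

theorem xorAssignment_of_ne {m : ℕ} (b : Fin m → Bool) {i j : Fin m} (h : i ≠ j) :
    xorAssignment b s(i, j) = xor (b i) (b j) := by
  simp [xorAssignment, h]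

theorem setOf_cutFormula_satisfies (m : ℕ) :
    {a | (cutFormula m).Satisfies a} = Set.range (xorAssignment (m := m)) := by
  ext a
  rw [Set.mem_ofPred_eq, cutFormula_satisfies_iff]
  constructor
  · refine fun h => ⟨fun i => a s(i, i), funext fun e => ?_⟩
    induction e using Sym2.ind with
    | _ i j =>
    by_cases hij : i = j
    · subst hij
      exact xorAssignment_diag _ i
    · rw [xorAssignment_of_ne _ hij, h i j hij]
  · rintro ⟨b, rfl⟩ i j hij
    rw [xorAssignment_of_ne _ hij, xorAssignment_diag, xorAssignment_diag]

/-- Off the diagonal the assignment of `b` is b_i ⊕ b_j, which is the cut vector of the support of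
`b`. -/
theorem image_satPolytope_cutFormula (m : ℕ) :
    LinearMap.funLeft ℝ ℝ (Subtype.val : (⊤ : SimpleGraph (Fin m)).edgeSet → Sym2 (Fin m)) ''
      satPolytope (cutFormula m) = cutPolytope (⊤ : SimpleGraph (Fin m)) := by
  classical
  have key : ∀ b : Fin m → Bool, LinearMap.funLeft ℝ ℝ
      (Subtype.val : (⊤ : SimpleGraph (Fin m)).edgeSet → Sym2 (Fin m))
      (assignmentVector (xorAssignment b)) = cutVector ⊤ {i | b i = true} := by
    intro b
    funext ⟨e, he⟩
    induction e using Sym2.ind with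
    | _ i j =>
    have hij : i ≠ j := by simpa using he
    simp only [LinearMap.funLeft_apply, assignmentVector, cutVector, xorAssignment_of_ne b hij,
      Set.mem_ofPred_eq, Sym2.mem_iff]
    congr 1
    rw [eq_iff_iff]
    cases hi : b i <;> cases hj : b j
    · have : {v | b v = true ∧ (v = i ∨ v = j)} = ∅ := by ext v; simp; grind
      simp [this]
    · have : {v | b v = true ∧ (v = i ∨ v = j)} = {j} := by ext v; simp; grind
      simp [this]
    · have : {v | b v = true ∧ (v = i ∨ v = j)} = {i} := by ext v; simp; grind
      simp [this]
    · have : {v | b v = true ∧ (v = i ∨ v = j)} = {i, j} := by ext v; simp; grind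
      simp [this, Set.ncard_pair hij]
  rw [satPolytope, cutPolytope, LinearMap.image_convexHull, setOf_cutFormula_satisfies,
    ← Set.range_comp, ← Set.range_comp]
  congr 1
  ext x
  constructor
  · rintro ⟨b, rfl⟩
    exact ⟨_, (key b).symm⟩
  · rintro ⟨S, rfl⟩
    exact ⟨fun i => decide (i ∈ S), (key _).trans (by simp)⟩

/-- The product `b i * b j` in terms of the variables of `Φ_m`. -/
def pairProduct {m : ℕ} (i j : Fin m) : (Sym2 (Fin m) → ℝ) →ₗ[ℝ] ℝ :=
  let x (e : Sym2 (Fin m)) : (Sym2 (Fin m) → ℝ) →ₗ[ℝ] ℝ := LinearMap.proj e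
  -- For bits, b_i + b_j - (b_i ⊕ b_j) = 2 b_i b_j, and b_i² = b_i.
  if i = j then x s(i, i) else (1 / 2 : ℝ) • (x s(i, i) + x s(j, j) - x s(i, j))

theorem pairProduct_apply {m : ℕ} (b : Fin m → Bool) (i j : Fin m) :
    pairProduct i j (assignmentVector (xorAssignment b)) = (b i).toNat * (b j).toNat := by
  by_cases h : i = j
  · subst h
    cases hi : b i <;> simp [pairProduct, assignmentVector, xorAssignment_diag, hi]
  · cases hi : b i <;> cases hj : b j <;>
      simp [pairProduct, h, assignmentVector, xorAssignment_diag, xorAssignment_of_ne, hi, hj]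
    norm_num

/-- The affine function with the value `(1 - |a ∩ b|) ^ 2` at the assignment given by `b`. -/
def disjointnessSlack {m : ℕ} (a : Fin m → Bool) : (Sym2 (Fin m) → ℝ) →ᵃ[ℝ] ℝ :=
  AffineMap.const ℝ _ 1 + (∑ i, ∑ j, ((a i).toNat * (a j).toNat : ℝ) • pairProduct i j -
    (2 : ℝ) • ∑ i, ((a i).toNat : ℝ) • pairProduct i i).toAffineMap

theorem disjointnessSlack_apply {m : ℕ} (a b : Fin m → Bool) :
    disjointnessSlack a (assignmentVector (xorAssignment b)) =
      (1 - (interCard a b : ℝ)) ^ 2 := by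
  have hN : (interCard a b : ℝ) = ∑ i, ((a i).toNat : ℝ) * (b i).toNat := by
    simp only [interCard, Nat.cast_sum]
    refine Finset.sum_congr rfl fun i _ => ?_
    cases a i <;> cases b i <;> simp
  have hsq : ∀ i, ((b i).toNat : ℝ) * (b i).toNat = (b i).toNat := fun i => by
    cases b i <;> simp
  have hL : disjointnessSlack a (assignmentVector (xorAssignment b)) =
      1 + (∑ i, ∑ j, ((a i).toNat * (a j).toNat : ℝ) * ((b i).toNat * (b j).toNat) -
        2 * ∑ i, ((a i).toNat : ℝ) * (b i).toNat) := by
    simp [disjointnessSlack, LinearMap.sum_apply, pairProduct_apply, hsq]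
  have hprod : (∑ i, ((a i).toNat : ℝ) * (b i).toNat) * (∑ j, ((a j).toNat : ℝ) * (b j).toNat) =
      ∑ i, ∑ j, ((a i).toNat * (a j).toNat : ℝ) * ((b i).toNat * (b j).toNat) := by
    rw [Finset.sum_mul_sum]
    refine Finset.sum_congr rfl fun i _ => Finset.sum_congr rfl fun j _ => by ring
  rw [hL, hN, ← hprod]
  ring

theorem three_pow_le_extensionComplexity_cutFormula (m : ℕ) :
    3 ^ m ≤ extensionComplexity (satPolytope (cutFormula m)) * 2 ^ m := by
  refine three_pow_le_extensionComplexity_mul (isPolytope_satPolytope _) disjointnessSlack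
    (fun b => assignmentVector (xorAssignment b)) (fun b => ?_) (fun a => ?_)
    disjointnessSlack_apply
  · refine subset_convexHull ℝ _ ⟨_, ?_, rfl⟩
    rw [setOf_cutFormula_satisfies]
    exact ⟨b, rfl⟩
  · refine nonneg_on_convexHull _ ?_
    rw [setOf_cutFormula_satisfies]
    rintro _ ⟨_, ⟨b, rfl⟩, rfl⟩
    rw [disjointnessSlack_apply]
    positivity

theorem two_rpow_le_extensionComplexity_cutFormula (m : ℕ) :
    (2 : ℝ) ^ (Real.logb 2 (3 / 2) * m) ≤ extensionComplexity (satPolytope (cutFormula m)) := by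
  rw [Real.rpow_mul (by norm_num), Real.rpow_logb (by norm_num) (by norm_num) (by norm_num),
    Real.rpow_natCast, div_pow, div_le_iff₀ (by positivity)]
  exact_mod_cast three_pow_le_extensionComplexity_cutFormula m

/-! ### Renaming variables -/

/-- The clause with its variables renamed. -/
def ThreeClause.rename {σ τ : Type*} (e : σ ↪ τ) : ThreeClause σ ↪ ThreeClause τ where
  toFun C := ⟨C.var.trans e, C.sign⟩
  inj' := by
    rintro ⟨v, s⟩ ⟨v', s'⟩ h
    simp only [ThreeClause.mk.injEq] at h
    obtain ⟨h, rfl⟩ := h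
    congr 1
    ext k
    exact e.injective (DFunLike.congr_fun h k)

theorem satisfies_map_rename {σ τ : Type*} (e : σ ↪ τ) (Φ : ThreeCNF σ) (a : τ → Bool) :
    ThreeCNF.Satisfies (Φ.map (ThreeClause.rename e)) a ↔ Φ.Satisfies (a ∘ e) := by
  simp only [ThreeCNF.Satisfies, Finset.forall_mem_map]
  rfl

theorem image_satPolytope_map_rename {σ τ : Type*} (e : σ ≃ τ) (Φ : ThreeCNF σ) :
    LinearMap.funLeft ℝ ℝ e '' satPolytope (Φ.map (ThreeClause.rename e.toEmbedding)) =
      satPolytope Φ := by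
  rw [satPolytope, satPolytope, LinearMap.image_convexHull, ← Set.image_comp]
  congr 1
  ext x
  constructor
  · rintro ⟨a, ha, rfl⟩
    exact ⟨a ∘ e, (satisfies_map_rename _ _ _).1 ha, rfl⟩
  · rintro ⟨a, ha, rfl⟩
    refine ⟨a ∘ e.symm, (satisfies_map_rename _ _ _).2 ?_, ?_⟩
    · have h : (a ∘ e.symm) ∘ e.toEmbedding = a := by
        ext v
        simp
      rwa [h]
    · funext v
      simp [LinearMap.funLeft_apply, assignmentVector]

theorem exists_threeCNF_fin (m : ℕ) : ∃ Φ : ThreeCNF (Fin ((m + 1).choose 2)),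
    Φ.card = 4 * m.choose 2 ∧
      (2 : ℝ) ^ (Real.logb 2 (3 / 2) * m) ≤ extensionComplexity (satPolytope Φ) := by
  have hcard : Fintype.card (Sym2 (Fin m)) = (m + 1).choose 2 := by
    rw [Sym2.card, Fintype.card_fin]
  let e := Fintype.equivFinOfCardEq hcard
  refine ⟨(cutFormula m).map (ThreeClause.rename e.toEmbedding), ?_, ?_⟩
  · rw [Finset.card_map, card_cutFormula]
  · refine (two_rpow_le_extensionComplexity_cutFormula m).trans (Nat.cast_le.2 ?_)
    have h := extensionComplexity_image_le
      (isPolytope_satPolytope ((cutFormula m).map (ThreeClause.rename e.toEmbedding)))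
      (LinearMap.funLeft ℝ ℝ e)
    rwa [image_satPolytope_map_rename] at h

end

theorem mainTheorem7 :
    (∃ C c : ℝ, 0 < C ∧ 0 < c ∧ ∀ n : ℕ, 1 ≤ n → ∃ (N : ℕ) (Φ : ThreeCNF (Fin N)),
      (N : ℝ) ≤ C * n ∧ (Φ.card : ℝ) ≤ C * n ∧
        (2 : ℝ) ^ (c * Real.sqrt n) ≤ extensionComplexity (satPolytope Φ)) ∧
    (∀ m : ℕ,
      (∀ a : Sym2 (Fin m) → Bool, (cutFormula m).Satisfies a ↔
        ∀ i j : Fin m, i ≠ j → a s(i, j) = xor (a s(i, i)) (a s(j, j))) ∧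
      Nat.card (Sym2 (Fin m)) = (m + 1).choose 2 ∧ (cutFormula m).card = 4 * m.choose 2 ∧
      LinearMap.funLeft ℝ ℝ (Subtype.val : (⊤ : SimpleGraph (Fin m)).edgeSet → Sym2 (Fin m)) ''
        satPolytope (cutFormula m) = cutPolytope (⊤ : SimpleGraph (Fin m))) ∧
    (∃ c : ℝ, 0 < c ∧ ∀ m : ℕ, 1 ≤ m →
      (2 : ℝ) ^ (c * m) ≤ extensionComplexity (satPolytope (cutFormula m))) := by
  have hc : 0 < Real.logb 2 (3 / 2) := Real.logb_pos (by norm_num) (by norm_num)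
  -- With m = ⌊√n⌋ there are m(m+1)/2 ≤ n variables and 2m(m-1) ≤ 2n clauses. The exponent is halved
  -- because √n ≤ m + 1 ≤ 2m.
  refine ⟨⟨2, Real.logb 2 (3 / 2) / 2, by norm_num, by positivity, fun n hn => ?_⟩, fun m =>
    ⟨cutFormula_satisfies_iff, ?_, card_cutFormula m, image_satPolytope_cutFormula m⟩,
    ⟨_, hc, fun m _ => two_rpow_le_extensionComplexity_cutFormula m⟩⟩
  · obtain ⟨Φ, hcard, hΦ⟩ := exists_threeCNF_fin n.sqrt
    have hsq : (n.sqrt : ℝ) * n.sqrt ≤ n := by exact_mod_cast n.sqrt_le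
    have hpos : (1 : ℝ) ≤ n.sqrt := by exact_mod_cast Nat.sqrt_pos.2 hn
    refine ⟨_, Φ, ?_, ?_, le_trans ?_ hΦ⟩
    · rw [Nat.cast_choose_two]
      push_cast
      nlinarith
    · rw [hcard]
      push_cast
      rw [Nat.cast_choose_two]
      nlinarith
    · refine Real.rpow_le_rpow_of_exponent_le (by norm_num) ?_
      have h := Real.nat_sqrt_le_real_sqrt (a := n)
      have h' := Real.real_sqrt_le_nat_sqrt_succ (a := n)
      nlinarith
  · rw [Nat.card_eq_fintype_card, Sym2.card, Fintype.card_fin]
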